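/- A triangulation $T$ is a locally finite connected planar graph, without loops but possibly with multiple edges, embedded in the oriented sphere, together with a set $F(T)$ of its triangular faces (the triangles of $T$), such that every edge lies on a triangle of $T$. Triangulations are considered up to orientation preserving homeomorphisms of their supports (the support is the union of the graph and the triangles). A root $o=(x,y,z)$ of $T$ is a triangle of $T$ together with the choice of one of its three positively oriented orderings. The combinatorial ball $B_r(T,o)$ is defined by $B_0=\{x\}$ and by letting $B_{r+1}$ consist of all triangles of $T$ incident to a vertex of $B_r$, with their vertices and edges. A center embedding is a triple $(T,o,g)$ with $(T,o)$ a rooted triangulation and $g:F(T)\to\mathbb C$ injective, normalized by $g(o)=0$ and $\inf_{f\ne o}|g(f)|=1$. The space $\mathcal E$ of center embeddings (up to equivalence) carries the metrizable topology in which $(T_n,o_n,g_n)\to(T,o,g)$ if and only if for every $r$ and $\varepsilon>0$ and all large $n$ there is a root preserving equivalence $B_r(T,o)\cong B_r(T_n,o_n)$ such that $|g_n(f')-g(f)|\le\varepsilon$ whenever the triangle $f$ of $B_r(T,o)$ corresponds to $f'$. A random center embedding is a random element of $\mathcal E$ (with its Borel $\sigma$-algebra). Call $g,g'$ similar if $g'=ag+b$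 with $a>0$ real and $b\in\mathbb C$. **Proposition.** Let $E_n=(T_n,o_n,g_n)$, $n\in\mathbb N$, be random center embeddings such that, for each $n$: 1. $T_n$ is almost surely finite; 2. $E_n$ is unbiased: conditionally on the unrooted triangulation $T_n$, the root $o_n$ is uniformly distributed among the oriented triangles of $T_n$. Here $T_n$ is regarded as a triangulation with labelled triangles (for example, a fixed representative of its equivalence class), so that the triangles of $T_n$ are distinguishable even if $T_n$ has symmetries; 3. $T_n$ determines the embedding up to similarity: there is an assignment $T\mapsto\varphi_T:F(T)\to\mathbb C$ such that $g_n$ is almost surely similar to $\varphi_{T_n}$, and such that whenever $T$ and $T'$ are equivalent there is an equivalence that transports $\varphi_{T'}$ to a map similar to $\varphi_T$. Let $E=(T,o,g)$ be a limit in distribution of a subsequence of $(E_n)$ in $\mathcal E$. Then almost surely the set $g(F(T))$ has at most one accumulation point in $\mathbb C$. -/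

import Mathlib

open Set Filter Topology MeasureTheory

noncomputable section

namespace CenterEmb

/-! ### Planar maps

A graph drawn in the oriented sphere is encoded in the usual way by its rotation system: a type of
darts (edges with a direction), the involution `opp` reversing a dart, and the permutation `rot`
sending a dart to the next one, in clockwise order, with the same origin. Vertices, edges and faces
are the orbits of `rot`, `opp` and `rot * opp` respectively; the face of `d` lies to its left. -/

section Map
variable {D : Type} (opp rot : Equiv.Perm D)

/-- The first dart of `S` met when turning clockwise from `d` (starting after `d`) around the origin
of `d`: this is the rotation of the subgraph with set of darts `S`. -/
def subRot (S : Set D) (d : D) : D := (rot ^ sInf {n : ℕ | 0 < n ∧ (rot ^ n) d ∈ S}) d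

/-- Number of vertices of the subgraph with set of darts `S`. -/
def numVertices (S : Set D) : ℕ := Nat.card (Quot fun a b : S => (b : D) = subRot rot S a)

/-- Number of faces (boundary walks) of the subgraph with set of darts `S`. -/
def numFaces (S : Set D) : ℕ := Nat.card (Quot fun a b : S => (b : D) = subRot rot S (opp a))

/-- Number of connected components of the subgraph with set of darts `S`. -/
def numComponents (S : Set D) : ℕ :=
  Nat.card (Quot fun a b : S => (b : D) = opp a ∨ (b : D) = subRot rot S a)

/-- The rotation system has genus zero: every finite subgraph satisfies Euler's formula
`V - E + F = 2 C`, where `2 E` is the number of darts and `C` the number of components. -/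
def IsPlanar : Prop :=
  ∀ S : Set D, S.Finite → (∀ d ∈ S, opp d ∈ S) →
    2 * numVertices rot S + 2 * numFaces opp rot S = S.ncard + 4 * numComponents opp rot S

end Map

/-! ### Triangulations -/

/-- A (finite or infinite, locally finite, connected) triangulation embedded in the sphere: a planar
graph without loops, possibly with multiple edges, together with a set of triangular faces, whose
boundary darts form the set `tri`. Every edge belongs to one of the chosen triangles. -/
structure Triangulation where
  Dart : Type
  opp : Equiv.Perm Dart
  rot : Equiv.Perm Dart
  opp_opp : ∀ d, opp (opp d) = d
  locallyFinite : ∀ d, {e | rot.SameCycle d e}.Finite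
  connected : ∀ d e, Relation.EqvGen (fun a b => b = opp a ∨ b = rot a) d e
  planar : IsPlanar opp rot
  loopless : ∀ d, ¬ rot.SameCycle d (opp d)
  tri : Set Dart
  tri_next : ∀ d ∈ tri, (rot * opp) d ∈ tri
  tri_three : ∀ d ∈ tri, ((rot * opp) ^ 3) d = d
  tri_cover : ∀ d, d ∈ tri ∨ opp d ∈ tri

namespace Triangulation

/-- The next dart on the boundary of the face to the left of a dart. -/
def next (T : Triangulation) : Equiv.Perm T.Dart := T.rot * T.opp

/-- The set `F(T)` of triangles of `T`: orbits of `next` on `tri`. -/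
def Face (T : Triangulation) : Type :=
  Quotient ((Equiv.Perm.SameCycle.setoid T.next).comap (Subtype.val : T.tri → T.Dart))

/-- The triangle to the left of a dart. -/
def face (T : Triangulation) (d : T.tri) : T.Face := Quotient.mk _ d

/-- The set of boundary darts of the triangles of the combinatorial ball of radius `r` around the
origin of `o`: the ball of radius `0` is that vertex only, and the ball of radius `r + 1` consists of
the triangles with a vertex in the ball of radius `r`. -/
def ball (T : Triangulation) (o : T.Dart) : ℕ → Set T.Dart
  | 0 => ∅
  | r + 1 => {d | d ∈ T.tri ∧ ∃ i : ℕ, T.rot.SameCycle o ((T.next ^ i) d) ∨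
      ∃ e ∈ ball T o r, T.rot.SameCycle e ((T.next ^ i) d)}

end Triangulation

/-- Orientation preserving equivalence between the complex spanned by a set `S` of triangles of `T`
and the complex spanned by a set `S'` of triangles of `T'` (triangles being given through their
boundary darts): a bijection respecting the cyclic order of the sides of the triangles, equality of
vertices, and equality of edges. -/
structure CellEquiv (T T' : Triangulation) (S : Set T.Dart) (S' : Set T'.Dart) where
  toEquiv : S ≃ S'
  next_iff : ∀ d e : S, T.next d = e ↔ T'.next (toEquiv d) = toEquiv e
  vertex_iff : ∀ d e : S, T.rot.SameCycle d e ↔ T'.rot.SameCycle (toEquiv d) (toEquiv e)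
  edge_iff : ∀ d e : S, T.opp d = e ↔ T'.opp (toEquiv d) = toEquiv e

/-- A rooted triangulation. An oriented triangle `(x, y, z)` (in the orientation of the sphere) is
the same thing as the dart `d ∈ tri` going from `x` to `y`. -/
structure RootedTriangulation where
  T : Triangulation
  root : T.tri

/-- Two maps to `ℂ` are similar if they differ by a real dilation and a complex translation. -/
def Similar {α : Type} (g g' : α → ℂ) : Prop :=
  ∃ (a : ℝ) (b : ℂ), 0 < a ∧ ∀ x, g' x = (a : ℂ) * g x + b

/-- A normalized center embedding `(T, o, g)`. -/
structure CenterEmbedding extends RootedTriangulation where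
  g : T.Face → ℂ
  inj : Function.Injective g
  g_root : g (T.face root) = 0
  normalized : IsGLB {x : ℝ | ∃ f, f ≠ T.face root ∧ x = ‖g f‖} 1

namespace Triangulation

theorem ball_subset_tri (T : Triangulation) (o : T.Dart) (r : ℕ) : T.ball o r ⊆ T.tri := by
  cases r with
  | zero => intro d hd; exact hd.elim
  | succ r => intro d hd; exact hd.1

theorem ball_succ_mono (T : Triangulation) (o : T.Dart) (r : ℕ) :
    T.ball o r ⊆ T.ball o (r + 1) := by
  induction r with
  | zero => intro d hd; exact hd.elim
  | succ r ih =>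
    rintro d ⟨hd, i, h⟩
    refine ⟨hd, i, h.imp id ?_⟩
    rintro ⟨e, he, h⟩
    exact ⟨e, ih he, h⟩

theorem ball_mono (T : Triangulation) (o : T.Dart) : Monotone (T.ball o) :=
  monotone_nat_of_le_succ (T.ball_succ_mono o)

theorem next_pow_mem_ball (T : Triangulation) (o : T.Dart) {r : ℕ} {d : T.Dart}
    (hd : d ∈ T.ball o r) (j : ℕ) : (T.next ^ j) d ∈ T.ball o r := by
  induction j with
  | zero => simpa using hd
  | succ j ih =>
    rw [pow_succ', Equiv.Perm.mul_apply]
    generalize (T.next ^ j) d = e at ih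
    cases r with
    | zero => exact ih.elim
    | succ r =>
      obtain ⟨he, i, h⟩ := ih
      refine ⟨T.tri_next e he, i + 2, ?_⟩
      have : (T.next ^ (i + 2)) (T.next e) = (T.next ^ i) e := by
        rw [← Equiv.Perm.mul_apply, ← pow_succ, add_assoc, pow_add, Equiv.Perm.mul_apply]
        exact congrArg _ (T.tri_three e he)
      rw [this]; exact h

theorem root_mem_ball (T : Triangulation) (o : T.tri) (r : ℕ) : (o : T.Dart) ∈ T.ball o (r + 1) :=
  ⟨o.2, 0, Or.inl (by simpa using Equiv.Perm.SameCycle.refl _ _)⟩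

end Triangulation

namespace CenterEmbedding

/-- The face of a dart in the ball around the root. -/
def ballFace (E : CenterEmbedding) {r : ℕ} (d : E.T.ball E.root r) : E.T.Face :=
  E.T.face ⟨d, E.T.ball_subset_tri _ _ d.2⟩

/-- There is a root preserving equivalence of the combinatorial balls of radius `r` of the two rooted
triangulations such that the images of corresponding triangles of these balls are at distance at most
`ε`. -/
def Agree (E E' : CenterEmbedding) (r : ℕ) (ε : ℝ) : Prop :=
  ∃ ψ : CellEquiv E.T E'.T (E.T.ball E.root r) (E'.T.ball E'.root r),
    (∀ d : E.T.ball E.root r, (d : E.T.Dart) = E.root ↔ (ψ.toEquiv d : E'.T.Dart) = E'.root) ∧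
    ∀ d : E.T.ball E.root r, ‖E.g (E.ballFace d) - E'.g (E'.ballFace (ψ.toEquiv d))‖ ≤ ε

theorem Agree.symm {E E' : CenterEmbedding} {r : ℕ} {ε : ℝ} (h : E.Agree E' r ε) :
    E'.Agree E r ε := by
  obtain ⟨ψ, h1, h2⟩ := h
  refine ⟨⟨ψ.toEquiv.symm, fun d e => ?_, fun d e => ?_, fun d e => ?_⟩, fun d => ?_, fun d => ?_⟩
  · rw [ψ.next_iff]; simp
  · rw [ψ.vertex_iff]; simp
  · rw [ψ.edge_iff]; simp
  · rw [h1]; simp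
  · have := h2 (ψ.toEquiv.symm d)
    rw [norm_sub_rev]
    simpa using this

theorem Agree.trans {E E' E'' : CenterEmbedding} {r : ℕ} {ε ε' : ℝ} (h : E.Agree E' r ε)
    (h' : E'.Agree E'' r ε') : E.Agree E'' r (ε + ε') := by
  obtain ⟨ψ, h1, h2⟩ := h
  obtain ⟨χ, h3, h4⟩ := h'
  refine ⟨⟨ψ.toEquiv.trans χ.toEquiv, fun d e => ?_, fun d e => ?_, fun d e => ?_⟩,
    fun d => ?_, fun d => ?_⟩
  · rw [ψ.next_iff, χ.next_iff]; rfl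
  · rw [ψ.vertex_iff, χ.vertex_iff]; rfl
  · rw [ψ.edge_iff, χ.edge_iff]; rfl
  · rw [h1, h3]; rfl
  · have e1 := h2 d
    have e2 := h4 (ψ.toEquiv d)
    have := norm_sub_le_norm_sub_add_norm_sub (E.g (E.ballFace d))
      (E'.g (E'.ballFace (ψ.toEquiv d))) (E''.g (E''.ballFace (χ.toEquiv (ψ.toEquiv d))))
    exact this.trans (add_le_add e1 e2)

theorem agree_self (E : CenterEmbedding) {r : ℕ} {ε : ℝ} (hε : 0 ≤ ε) : E.Agree E r ε :=
  ⟨⟨Equiv.refl _, fun _ _ => Iff.rfl, fun _ _ => Iff.rfl, fun _ _ => Iff.rfl⟩,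
    fun _ => Iff.rfl, fun d => by simpa using hε⟩

theorem agree_zero (E E' : CenterEmbedding) (ε : ℝ) : E.Agree E' 0 ε :=
  ⟨⟨⟨fun d => d.2.elim, fun d => d.2.elim, fun d => d.2.elim, fun d => d.2.elim⟩,
    fun d => d.2.elim, fun d => d.2.elim, fun d => d.2.elim⟩,
    fun d => d.2.elim, fun d => d.2.elim⟩

theorem mem_ball_iff {E E' : CenterEmbedding} {s : ℕ}
    (ψ : CellEquiv E.T E'.T (E.T.ball E.root s) (E'.T.ball E'.root s))
    (h1 : ∀ d : E.T.ball E.root s, (d : E.T.Dart) = E.root ↔ (ψ.toEquiv d : E'.T.Dart) = E'.root)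
    (r : ℕ) (hr : r ≤ s) (d : E.T.ball E.root s) :
    (d : E.T.Dart) ∈ E.T.ball E.root r ↔ (ψ.toEquiv d : E'.T.Dart) ∈ E'.T.ball E'.root r := by
  induction r generalizing d with
  | zero => exact Iff.rfl
  | succ r ih =>
    obtain ⟨t, rfl⟩ : ∃ t, s = t + 1 := ⟨s - 1, by omega⟩
    have hpow : ∀ i : ℕ, (ψ.toEquiv ⟨(E.T.next ^ i) d, E.T.next_pow_mem_ball _ d.2 i⟩ : E'.T.Dart) =
        (E'.T.next ^ i) (ψ.toEquiv d) := by
      intro i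
      induction i with
      | zero => rfl
      | succ i ihi =>
        have := (ψ.next_iff ⟨(E.T.next ^ i) d, E.T.next_pow_mem_ball _ d.2 i⟩
          ⟨(E.T.next ^ (i + 1)) d, E.T.next_pow_mem_ball _ d.2 (i + 1)⟩).1
          (by simp only [pow_succ']; rfl)
        rw [← this, ihi, pow_succ']; rfl
    have hroot : (ψ.toEquiv ⟨E.root, E.T.root_mem_ball _ t⟩ : E'.T.Dart) = E'.root :=
      (h1 ⟨E.root, E.T.root_mem_ball _ t⟩).1 rfl
    have key : ∀ i : ℕ, (E.T.rot.SameCycle E.root ((E.T.next ^ i) d) ∨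
        ∃ e ∈ E.T.ball E.root r, E.T.rot.SameCycle e ((E.T.next ^ i) d)) ↔
        (E'.T.rot.SameCycle E'.root ((E'.T.next ^ i) (ψ.toEquiv d)) ∨
        ∃ e ∈ E'.T.ball E'.root r, E'.T.rot.SameCycle e ((E'.T.next ^ i) (ψ.toEquiv d))) := by
      intro i
      have hv := ψ.vertex_iff ⟨E.root, E.T.root_mem_ball _ t⟩
        ⟨(E.T.next ^ i) d, E.T.next_pow_mem_ball _ d.2 i⟩
      rw [hpow, hroot] at hv
      refine or_congr hv ⟨?_, ?_⟩
      · rintro ⟨e, he, h⟩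
        have hes := E.T.ball_mono _ (by omega : r ≤ t + 1) he
        refine ⟨ψ.toEquiv ⟨e, hes⟩, (ih (by omega) ⟨e, hes⟩).1 he, ?_⟩
        rw [← hpow]
        exact (ψ.vertex_iff ⟨e, hes⟩ ⟨_, E.T.next_pow_mem_ball _ d.2 i⟩).1 h
      · rintro ⟨e, he, h⟩
        have hes := E'.T.ball_mono _ (by omega : r ≤ t + 1) he
        refine ⟨ψ.toEquiv.symm ⟨e, hes⟩, (ih (by omega) _).2 (by simpa using he), ?_⟩
        refine (ψ.vertex_iff _ ⟨_, E.T.next_pow_mem_ball _ d.2 i⟩).2 ?_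
        rw [hpow]
        simpa using h
    constructor
    · rintro ⟨_, i, h⟩
      exact ⟨E'.T.ball_subset_tri _ _ (ψ.toEquiv d).2, i, (key i).1 h⟩
    · rintro ⟨_, i, h⟩
      exact ⟨E.T.ball_subset_tri _ _ d.2, i, (key i).2 h⟩

theorem Agree.mono {E E' : CenterEmbedding} {r s : ℕ} {ε : ℝ} (h : E.Agree E' s ε) (hr : r ≤ s) :
    E.Agree E' r ε := by
  obtain ⟨ψ, h1, h2⟩ := h
  have hm := mem_ball_iff ψ h1 r hr
  have i1 := E.T.ball_mono E.root hr
  have i2 := E'.T.ball_mono E'.root hr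
  refine ⟨⟨⟨fun d => ⟨ψ.toEquiv ⟨d, i1 d.2⟩, (hm _).1 d.2⟩,
      fun d => ⟨ψ.toEquiv.symm ⟨d, i2 d.2⟩, (hm _).2 (by simp)⟩,
      fun d => by simp, fun d => by simp⟩, fun d e => ?_, fun d e => ?_, fun d e => ?_⟩,
    fun d => ?_, fun d => ?_⟩
  · exact ψ.next_iff ⟨d, i1 d.2⟩ ⟨e, i1 e.2⟩
  · exact ψ.vertex_iff ⟨d, i1 d.2⟩ ⟨e, i1 e.2⟩
  · exact ψ.edge_iff ⟨d, i1 d.2⟩ ⟨e, i1 e.2⟩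
  · exact h1 ⟨d, i1 d.2⟩
  · exact h2 ⟨d, i1 d.2⟩

/-- The radii `ε` admitted in the definition of the distance. -/
def agreeSet (E E' : CenterEmbedding) : Set ℝ := {ε | 0 < ε ∧ E.Agree E' ⌊ε⁻¹⌋₊ ε}

theorem two_mem_agreeSet (E E' : CenterEmbedding) : 2 ∈ agreeSet E E' := by
  refine ⟨two_pos, ?_⟩
  have : ⌊(2 : ℝ)⁻¹⌋₊ = 0 := Nat.floor_eq_zero.2 (by norm_num)
  rw [this]
  exact agree_zero _ _ _

theorem bddBelow_agreeSet (E E' : CenterEmbedding) : BddBelow (agreeSet E E') :=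
  ⟨0, fun _ h => h.1.le⟩

/-- Two center embeddings are close if large combinatorial balls around the roots are equivalent and
the embeddings are close to each other on these balls. So `(T_n, o_n, g_n)` converges to `(T, o, g)`
if and only if `(T_n, o_n)` converges to `(T, o)` in the combinatorial distance and `g_n (f)`
converges to `g (f)` for every triangle `f` of `T`. Equivalent center embeddings are at distance
zero, and the Borel sets of this topology do not separate them. -/
instance : PseudoMetricSpace CenterEmbedding where
  dist E E' := sInf (agreeSet E E')
  dist_self E := by
    refine le_antisymm (le_of_forall_pos_le_add fun ε hε => ?_) (Real.sInf_nonneg fun x hx => hx.1.le)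
    rw [zero_add]
    exact csInf_le (bddBelow_agreeSet _ _) ⟨hε, agree_self E hε.le⟩
  dist_comm E E' := by
    congr 1
    ext ε
    exact ⟨fun h => ⟨h.1, h.2.symm⟩, fun h => ⟨h.1, h.2.symm⟩⟩
  dist_triangle E E' E'' := by
    refine le_of_forall_pos_le_add fun η hη => ?_
    obtain ⟨a, ha, ha'⟩ := exists_lt_of_csInf_lt ⟨_, two_mem_agreeSet E E'⟩
      (lt_add_of_pos_right (sInf (agreeSet E E')) (half_pos hη))
    obtain ⟨b, hb, hb'⟩ := exists_lt_of_csInf_lt ⟨_, two_mem_agreeSet E' E''⟩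
      (lt_add_of_pos_right (sInf (agreeSet E' E'')) (half_pos hη))
    have hab : a + b ∈ agreeSet E E'' := by
      have h0 := add_pos ha.1 hb.1
      refine ⟨h0, (ha.2.mono ?_).trans (hb.2.mono ?_)⟩
      · exact Nat.floor_le_floor (inv_anti₀ ha.1 (by linarith [hb.1]))
      · exact Nat.floor_le_floor (inv_anti₀ hb.1 (by linarith [ha.1]))
    have := csInf_le (bddBelow_agreeSet E E'') hab
    linarith

instance : MeasurableSpace CenterEmbedding := borel CenterEmbedding

instance : BorelSpace CenterEmbedding := ⟨rfl⟩

end CenterEmbedding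

/-! ### Random center embeddings -/

/-- The law on the space of center embeddings of a random center embedding with countably many
values. -/
def law (Q : PMF CenterEmbedding) : ProbabilityMeasure CenterEmbedding :=
  ⟨Q.toMeasure, inferInstance⟩

/-- All triangulations occurring in `Q` are finite. -/
def IsFinite (Q : PMF CenterEmbedding) : Prop := ∀ E ∈ Q.support, Finite E.T.Dart

/-- Given the triangulation `T`, every oriented triangle of `T` has the same probability of being the
root. -/
def IsUnbiased (Q : PMF CenterEmbedding) : Prop :=
  ∀ (T : Triangulation) (o o' : T.tri),
    Q.map CenterEmbedding.toRootedTriangulation ⟨T, o⟩ =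
      Q.map CenterEmbedding.toRootedTriangulation ⟨T, o'⟩

/-- The unrooted triangulation determines the embedding up to similarity: there is an assignment
`T ↦ φ T : F(T) → ℂ` depending (up to similarity) only on the equivalence class of `T`, such that
almost surely `g` is similar to `φ T`. -/
def IsDetermined (Q : PMF CenterEmbedding) : Prop :=
  ∃ φ : (T : Triangulation) → T.Face → ℂ,
    (∀ T T' : Triangulation, Nonempty (CellEquiv T T' T.tri T'.tri) →
      ∃ ψ : CellEquiv T T' T.tri T'.tri,
        Similar (fun d : T.tri => φ T (T.face d)) (fun d => φ T' (T'.face (ψ.toEquiv d)))) ∧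
    ∀ E ∈ Q.support, Similar (φ E.T) E.g

end CenterEmb

end

noncomputable section

/-! Two accumulation points of the centers would give, for one fixed `δ` and every `s`, two well
separated discs of radius `δ` with at least `s` centers each (`twoClusters`). It suffices that this
event has probability `O(1/s)` under every law in the sequence, with a constant depending only on
`δ`. The event is open, so the bound passes to the limit law by the portmanteau theorem, and `s` can
then tend to infinity.

The bound for a finite unbiased embedding comes from plane geometry. Up to similarity the centers
form a set `C` determined by the triangulation, and the root is uniform. The normalization at the
root only fixes a scale: the root center `w` is at distance at least `ρ` from the rest of `C`, and
the two discs have radius `δρ` and lie within about `ρ/δ` of `w`. By `exists_card_supported_le` at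
most `c|C|/s` points of `C` have such a scale.

That lemma uses nested square grids of mesh `B ^ j`. With a suitable shift, a supported point lies
in a square that holds at least `s` points outside any one of its subsquares two levels below. A
potential argument (`sum_card_splitBlocks_le`) allows only `4|C|/s` such squares over all levels,
and isolation lets each square serve boundedly many supported points. -/

/-! ### Nested partitions and a potential -/

theorem sum_truncated_le {ι : Type*} (I : Finset ι) (x : ι → ℕ) (s : ℕ) :
    ∑ i ∈ I, (2 * x i - s) ≤ 2 * ∑ i ∈ I, x i - s := by
  classical
  induction I using Finset.induction_on with
  | empty => simp
  | insert a I ha ih => rw [Finset.sum_insert ha, Finset.sum_insert ha]; omega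

/-- If every part is below `s / 2`, the left-hand sum vanishes. Otherwise one part pays its own `s`,
and the others, with total at least `s`, lose at least another `s` on the left: two losses against
the single one on the right. -/
theorem sum_truncated_add_le {ι : Type*} (I : Finset ι) (x : ι → ℕ) (s : ℕ)
    (htot : s ≤ ∑ i ∈ I, x i) (h : ∀ i ∈ I, s + x i ≤ ∑ i ∈ I, x i) :
    ∑ i ∈ I, (2 * x i - s) + s ≤ 2 * ∑ i ∈ I, x i - s := by
  classical
  by_cases hbig : ∃ i ∈ I, s ≤ 2 * x i
  · obtain ⟨i, hi, hs⟩ := hbig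
    have h1 := h i hi
    have h2 := sum_truncated_le (I.erase i) x s
    rw [← Finset.add_sum_erase I x hi] at h1 ⊢
    rw [← Finset.add_sum_erase I (fun i => 2 * x i - s) hi]
    omega
  · push Not at hbig
    rw [Finset.sum_eq_zero fun i hi => by have := hbig i hi; omega]
    omega

open Classical in
/-- The blocks of the partition of `C` into fibres of `q` which, after removal of any single fibre
of `p`, still have at least `s` elements. -/
def splitBlocks {α β : Type*} (C : Finset α) (p q : α → β) (s : ℕ) : Finset β :=
  (C.image q).filter fun v => ∀ u, s ≤ (C.filter fun x => q x = v ∧ p x ≠ u).card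

theorem mem_splitBlocks {α β : Type*} {C : Finset α} {p q : α → β} {s : ℕ} {v : β} :
    v ∈ splitBlocks C p q s ↔ (∃ x ∈ C, q x = v) ∧
      ∀ u, ∃ A ⊆ C, (∀ x ∈ A, q x = v ∧ p x ≠ u) ∧ s ≤ A.card := by
  classical
  simp only [splitBlocks, Finset.mem_filter, Finset.mem_image]
  refine and_congr_right fun _ => forall_congr' fun u => ⟨fun h => ?_, ?_⟩
  · exact ⟨_, Finset.filter_subset _ _, fun x hx => (Finset.mem_filter.1 hx).2, h⟩
  · rintro ⟨A, hA, h, hs⟩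
    exact hs.trans (Finset.card_le_card fun x hx => Finset.mem_filter.2 ⟨hA hx, h x hx⟩)

open Classical in
/-- A potential of the partition of `C` into the fibres of `p`. -/
def potential {α β : Type*} (C : Finset α) (p : α → β) (s : ℕ) : ℕ :=
  ∑ u ∈ C.image p, (2 * (C.filter fun x => p x = u).card - s)

theorem potential_le {α β : Type*} (C : Finset α) (p : α → β) (s : ℕ) :
    potential C p s ≤ 2 * C.card := by
  classical
  rw [Finset.card_eq_sum_card_image p C, Finset.mul_sum]
  exact Finset.sum_le_sum fun _ _ => Nat.sub_le _ _

/-- Merging blocks never lowers the potential, since truncated `2x - s` is superadditive, and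
forming a split block raises it by at least `s`. -/
theorem potential_add_le {α β : Type*} (C : Finset α) (p q : α → β) (s : ℕ)
    (hpq : ∀ x ∈ C, ∀ y ∈ C, p x = p y → q x = q y) :
    potential C p s + s * (splitBlocks C p q s).card ≤ potential C q s := by
  classical
  have himg : C.image p = (C.image q).biUnion fun v => (C.filter fun x => q x = v).image p := by
    ext u
    simp only [Finset.mem_image, Finset.mem_biUnion, Finset.mem_filter]
    constructor
    · rintro ⟨x, hx, rfl⟩; exact ⟨q x, ⟨x, hx, rfl⟩, x, ⟨hx, rfl⟩, rfl⟩
    · rintro ⟨_, _, x, ⟨hx, _⟩, rfl⟩; exact ⟨x, hx, rfl⟩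
  have hdisj : ((C.image q : Finset β) : Set β).PairwiseDisjoint
      fun v => (C.filter fun x => q x = v).image p := by
    intro v _ v' _ hne
    refine Finset.disjoint_left.2 fun u hu hu' => hne ?_
    simp only [Finset.mem_image, Finset.mem_filter] at hu hu'
    obtain ⟨x, ⟨hx, rfl⟩, rfl⟩ := hu
    obtain ⟨y, ⟨hy, rfl⟩, h⟩ := hu'
    exact (hpq y hy x hx h).symm
  rw [potential, himg, Finset.sum_biUnion hdisj, splitBlocks, Finset.card_filter, Finset.mul_sum,
    ← Finset.sum_add_distrib, potential]
  refine Finset.sum_le_sum fun v _ => ?_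
  have hcard : ∀ u ∈ (C.filter fun x => q x = v).image p,
      (C.filter fun x => p x = u) = (C.filter fun x => q x = v).filter fun x => p x = u := by
    intro u hu
    simp only [Finset.mem_image, Finset.mem_filter] at hu
    obtain ⟨x, ⟨hx, rfl⟩, rfl⟩ := hu
    ext y
    simp only [Finset.mem_filter]
    exact ⟨fun h => ⟨⟨h.1, hpq y h.1 x hx h.2⟩, h.2⟩, fun h => ⟨h.1.1, h.2⟩⟩
  rw [Finset.sum_congr rfl fun u hu => by rw [hcard u hu]]
  rw [Finset.card_eq_sum_card_image p (C.filter fun x => q x = v)]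
  split_ifs with hv
  · rw [mul_one]
    have hsplit : ∀ u, s + ((C.filter fun x => q x = v).filter fun x => p x = u).card ≤
        (C.filter fun x => q x = v).card := by
      intro u
      have h1 := (hv u).trans (Finset.card_le_card (t := (C.filter fun x => q x = v).filter
        fun x => ¬ p x = u) fun x hx => by simpa [and_assoc] using hx)
      have h2 := Finset.card_filter_add_card_filter_not (s := C.filter fun x => q x = v)
        (fun x => p x = u)
      omega
    have hcs := Finset.card_eq_sum_card_image p (C.filter fun x => q x = v)
    -- Any label may be removed here; `v` is merely an available element of `β`.
    have htot : s ≤ (C.filter fun x => q x = v).card :=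
      (hv v).trans (Finset.card_le_card fun x hx => by
        simp only [Finset.mem_filter] at hx ⊢; exact ⟨hx.1, hx.2.1⟩)
    exact sum_truncated_add_le _ _ _ (hcs ▸ htot) fun u _ => hcs ▸ hsplit u
  · rw [mul_zero, add_zero]
    exact sum_truncated_le _ _ _

/-- In a sequence of coarser and coarser partitions of `C`, the number of blocks which split in an
essential way two levels below is at most `4 |C| / s`. -/
theorem sum_card_splitBlocks_le {α β : Type*} (C : Finset α) (cell : ℕ → α → β) (s M : ℕ)
    (hcell : ∀ n, ∀ x ∈ C, ∀ y ∈ C, cell n x = cell n y → cell (n + 1) x = cell (n + 1) y) :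
    s * ∑ n ∈ Finset.range M, (splitBlocks C (cell n) (cell (n + 2)) s).card ≤ 4 * C.card := by
  -- Each gain compares levels `n` and `n + 2`, so the even and odd levels telescope separately and
  -- two potentials remain.
  have key : s * ∑ n ∈ Finset.range M, (splitBlocks C (cell n) (cell (n + 2)) s).card ≤
      potential C (cell M) s + potential C (cell (M + 1)) s := by
    induction M with
    | zero => simp
    | succ M ih =>
      rw [Finset.sum_range_succ, mul_add]
      have := potential_add_le C (cell M) (cell (M + 2)) s fun x hx y hy h =>
        hcell _ x hx y hy (hcell _ x hx y hy h)
      rw [show M + 1 + 1 = M + 2 from rfl]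
      omega
  have h1 := potential_le C (cell M) s
  have h2 := potential_le C (cell (M + 1)) s
  omega

/-! ### Shifted grids -/

/-- The index of the interval containing `x` in the partition of the line into intervals of length
`B ^ j`, shifted by the proportion `t`. -/
def gridIndex (B : ℕ) (t : ℝ) (j : ℤ) (x : ℝ) : ℤ := ⌊x / (B : ℝ) ^ j - t⌋

/-- The grids are nested: the breakpoint `(k + t) B ^ (j + 1)` equals `(B k + (B - 1) t + t) B ^ j`,
a breakpoint of level `j` once `(B - 1) t` is an integer. -/
theorem gridIndex_succ {B : ℕ} (hB : 0 < B) {t : ℝ} {q : ℤ} (hq : ((B : ℝ) - 1) * t = q) (j : ℤ)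
    (x : ℝ) : gridIndex B t (j + 1) x = (gridIndex B t j x - q) / (B : ℤ) := by
  have hB' : (B : ℝ) ≠ 0 := by positivity
  rw [gridIndex, gridIndex, ← Int.floor_sub_intCast, ← Int.floor_div_natCast, ← hq, zpow_add_one₀ hB']
  congr 1
  field_simp
  ring

theorem abs_sub_lt_of_gridIndex_eq {B : ℕ} (hB : 0 < B) {t : ℝ} {j : ℤ} {x y : ℝ}
    (h : gridIndex B t j x = gridIndex B t j y) : |x - y| < (B : ℝ) ^ j := by
  have hL : (0 : ℝ) < (B : ℝ) ^ j := by positivity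
  have := Int.abs_sub_lt_one_of_floor_eq_floor h
  rw [sub_sub_sub_cancel_right, ← sub_div, abs_div, abs_of_pos hL, div_lt_one hL] at this
  exact this

/-- The one-third trick: an interval shorter than `1 / 3` cannot meet both `ℤ` and `ℤ + 1 / 3`. -/
theorem exists_shift_floor_eq {y r : ℝ} (hr : r < 1 / 6) :
    ∃ t : ℝ, (t = 0 ∨ t = 1 / 3) ∧ ∀ z, |z - y| ≤ r → ⌊z - t⌋ = ⌊y - t⌋ := by
  have hbd : ∀ z, |z - y| ≤ r → y - r ≤ z ∧ z ≤ y + r := fun z hz => by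
    constructor <;> linarith [abs_le.1 hz]
  by_cases h : ⌊y - r⌋ = ⌊y + r⌋
  · refine ⟨0, Or.inl rfl, ?_⟩
    have : ∀ z, |z - y| ≤ r → ⌊z⌋ = ⌊y - r⌋ := fun z hz =>
      le_antisymm (h ▸ Int.floor_le_floor (hbd z hz).2) (Int.floor_le_floor (hbd z hz).1)
    intro z hz
    have hy : |y - y| ≤ r := by simpa using (abs_nonneg _).trans hz
    rw [sub_zero, sub_zero, this z hz, this y hy]
  · refine ⟨1 / 3, Or.inr rfl, ?_⟩
    intro z hz
    have hy : |y - y| ≤ r := by simpa using (abs_nonneg _).trans hz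
    have hr0 : 0 ≤ r := by simpa using hy
    have hlt : ⌊y - r⌋ < ⌊y + r⌋ :=
      lt_of_le_of_ne (Int.floor_le_floor (by linarith)) h
    have h1 : y - r < (⌊y + r⌋ : ℝ) := Int.floor_lt.1 hlt
    have h2 : (⌊y + r⌋ : ℝ) ≤ y + r := Int.floor_le _
    have : ∀ z, |z - y| ≤ r → ⌊z - 1 / 3⌋ = ⌊y + r⌋ - 1 := fun z hz => by
      have := hbd z hz
      rw [Int.floor_eq_iff]
      push_cast
      constructor <;> linarith
    rw [this z hz, this y hy]

theorem exists_shift_gridIndex_eq {B : ℕ} (hB : 0 < B) {j : ℤ} {y r : ℝ}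
    (hr : r < (B : ℝ) ^ j / 6) :
    ∃ t : ℝ, (t = 0 ∨ t = 1 / 3) ∧ ∀ z, |z - y| ≤ r → gridIndex B t j z = gridIndex B t j y := by
  have hL : (0 : ℝ) < (B : ℝ) ^ j := by positivity
  obtain ⟨t, ht, h⟩ := exists_shift_floor_eq (y := y / (B : ℝ) ^ j) (r := r / (B : ℝ) ^ j)
    (by rw [div_lt_iff₀ hL]; linarith)
  refine ⟨t, ht, fun z hz => h _ ?_⟩
  rw [← sub_div, abs_div, abs_of_pos hL]
  gcongr

theorem gridIndex_mem_Icc {B : ℕ} (hB : 0 < B) {t : ℝ} {j v : ℤ} {x : ℝ}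
    (h : gridIndex B t (j + 2) x = v) :
    gridIndex B t j x ∈ Finset.Icc ⌊(B : ℝ) ^ 2 * (v + t) - t⌋
      (⌊(B : ℝ) ^ 2 * (v + t) - t⌋ + (B : ℤ) ^ 2) := by
  have hB' : (0 : ℝ) < B := by positivity
  have hL : (0 : ℝ) < (B : ℝ) ^ j := by positivity
  obtain ⟨h1, h2⟩ := Int.floor_eq_iff.1 h
  have e : x / (B : ℝ) ^ j = (B : ℝ) ^ 2 * (x / (B : ℝ) ^ (j + 2)) := by
    rw [zpow_add₀ hB'.ne']
    have : (B : ℝ) ^ (2 : ℤ) = (B : ℝ) ^ 2 := by norm_cast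
    rw [this]
    field_simp
  have hB2 : (0 : ℝ) < (B : ℝ) ^ 2 := by positivity
  rw [Finset.mem_Icc, gridIndex, e]
  have h3 : (B : ℝ) ^ 2 * (v + t) ≤ (B : ℝ) ^ 2 * (x / (B : ℝ) ^ (j + 2)) := by
    gcongr; linarith
  have h4 : (B : ℝ) ^ 2 * (x / (B : ℝ) ^ (j + 2)) ≤ (B : ℝ) ^ 2 * (v + t) + (B : ℝ) ^ 2 := by
    have := mul_le_mul_of_nonneg_left (show x / (B : ℝ) ^ (j + 2) ≤ v + t + 1 by linarith) hB2.le
    linarith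
  refine ⟨Int.floor_le_floor (by linarith), ?_⟩
  have : ⌊(B : ℝ) ^ 2 * (v + t) - t⌋ + (B : ℤ) ^ 2 =
      ⌊(B : ℝ) ^ 2 * (v + t) - t + (((B : ℤ) ^ 2 : ℤ) : ℝ)⌋ := (Int.floor_add_intCast _ _).symm
  rw [this]
  refine Int.floor_le_floor ?_
  push_cast
  linarith

/-- The square containing `z` in a square grid of mesh `B ^ j`. -/
def gridSquare (B : ℕ) (τ : ℝ × ℝ) (j : ℤ) (z : ℂ) : ℤ × ℤ :=
  (gridIndex B τ.1 j z.re, gridIndex B τ.2 j z.im)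

theorem dist_lt_of_gridSquare_eq {B : ℕ} (hB : 0 < B) {τ : ℝ × ℝ} {j : ℤ} {z w : ℂ}
    (h : gridSquare B τ j z = gridSquare B τ j w) : dist z w < 2 * (B : ℝ) ^ j := by
  obtain ⟨h1, h2⟩ := Prod.mk.inj h
  have h1 := abs_sub_lt_of_gridIndex_eq hB h1
  have h2 := abs_sub_lt_of_gridIndex_eq hB h2
  have h3 := Complex.norm_le_abs_re_add_abs_im (z - w)
  rw [Complex.sub_re, Complex.sub_im] at h3
  rw [Complex.dist_eq]
  linarith

/-! ### Counting supported points -/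

open Classical in
/-- `w` is isolated at scale `ρ` in `C`, while two distant small discs, not too far from `w` in this
scale, contain at least `s` points of `C` each. -/
def IsSupported (C : Finset ℂ) (δ : ℝ) (s : ℕ) (w : ℂ) (ρ : ℝ) : Prop :=
  0 < ρ ∧ (∀ x ∈ C, x ≠ w → ρ ≤ dist x w) ∧ ∃ a b : ℂ, dist a w ≤ ρ / δ ∧ dist b w ≤ ρ / δ ∧
    4 * (δ * ρ) ≤ dist a b ∧ s ≤ (C.filter fun x => dist x a < δ * ρ).card ∧
    s ≤ (C.filter fun x => dist x b < δ * ρ).card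

/-- Level `j` matches the disc radius `δρ`. Two levels up, the mesh exceeds six times `ρ/δ + δρ`, so
some shift puts `w` and both discs in one square. Squares of level `j` have diameter at most `2δρ`,
too small to meet both discs. -/
theorem IsSupported.exists_mem_splitBlocks {C : Finset ℂ} {δ : ℝ} {s : ℕ} {w : ℂ} {ρ : ℝ}
    (h : IsSupported C δ s w ρ) (hw : w ∈ C) {B : ℕ} (hB : 0 < B)
    (hBδ : 6 * (1 / δ + δ) ≤ B * δ) {j : ℤ} (hj : (B : ℝ) ^ j ≤ δ * ρ)
    (hj' : δ * ρ < (B : ℝ) ^ (j + 1)) :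
    ∃ τ : ℝ × ℝ, (τ.1 = 0 ∨ τ.1 = 1 / 3) ∧ (τ.2 = 0 ∨ τ.2 = 1 / 3) ∧
      gridSquare B τ (j + 2) w ∈
        splitBlocks C (gridSquare B τ j) (gridSquare B τ (j + 2)) s := by
  classical
  obtain ⟨hρ, -, a, b, ha, hb, hab, hsa, hsb⟩ := h
  have hB' : (0 : ℝ) < B := by positivity
  have hlarge : ρ / δ + δ * ρ < (B : ℝ) ^ (j + 2) / 6 := by
    have e : (B : ℝ) ^ (j + 2) = B * (B : ℝ) ^ (j + 1) := by
      rw [show j + 2 = j + 1 + 1 by ring, zpow_add_one₀ hB'.ne', mul_comm]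
    have h1 := mul_lt_mul_of_pos_left hj' hB'
    have h2 := mul_le_mul_of_nonneg_right hBδ hρ.le
    have h3 : 6 * (1 / δ + δ) * ρ = 6 * (ρ / δ + δ * ρ) := by ring
    rw [e]
    linarith
  obtain ⟨t, ht, h1⟩ := exists_shift_gridIndex_eq (y := w.re) hB hlarge
  obtain ⟨t', ht', h2⟩ := exists_shift_gridIndex_eq (y := w.im) hB hlarge
  have hclose : ∀ x a : ℂ, dist a w ≤ ρ / δ → dist x a < δ * ρ →
      gridSquare B (t, t') (j + 2) x = gridSquare B (t, t') (j + 2) w := by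
    intro x a ha hx
    have hxw : ‖x - w‖ ≤ ρ / δ + δ * ρ := by
      rw [← Complex.dist_eq]
      linarith [dist_triangle x a w]
    exact Prod.ext (h1 _ ((Complex.abs_re_le_norm (x - w)).trans hxw))
      (h2 _ ((Complex.abs_im_le_norm (x - w)).trans hxw))
  refine ⟨(t, t'), ht, ht', ?_⟩
  refine mem_splitBlocks.2 ⟨⟨w, hw, rfl⟩, fun u => ?_⟩
  -- If the square `u` meets the disc around `a`, it misses the one around `b`, whose points then
  -- serve; otherwise those around `a` do.
  by_cases hu : ∃ x, dist x a < δ * ρ ∧ gridSquare B (t, t') j x = u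
  · obtain ⟨x, hx, rfl⟩ := hu
    refine ⟨_, Finset.filter_subset _ _, fun y hy => ?_, hsb⟩
    have hy := (Finset.mem_filter.1 hy).2
    refine ⟨hclose y b hb hy, fun hyx => ?_⟩
    have h3 := dist_lt_of_gridSquare_eq hB hyx
    have h4 := dist_triangle4 a x y b
    rw [dist_comm a x, dist_comm x y] at h4
    linarith
  · push Not at hu
    refine ⟨_, Finset.filter_subset _ _, fun y hy => ?_, hsa⟩
    have hy := (Finset.mem_filter.1 hy).2
    exact ⟨hclose y a ha hy, hu y hy⟩

theorem card_supported_shift_le {C W : Finset ℂ} (hWC : W ⊆ C) {δ : ℝ} (hδ' : δ ≤ 1 / 2)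
    {s : ℕ} {ρ : ℂ → ℝ} (hW : ∀ w ∈ W, IsSupported C δ s w (ρ w)) {B : ℕ} (hB : 0 < B)
    {τ : ℝ × ℝ} {q q' : ℤ} (hq : ((B : ℝ) - 1) * τ.1 = q) (hq' : ((B : ℝ) - 1) * τ.2 = q')
    {j : ℂ → ℤ} (hj : ∀ w ∈ W, (B : ℝ) ^ (j w) ≤ δ * ρ w)
    (hmem : ∀ w ∈ W, gridSquare B τ (j w + 2) w ∈
      splitBlocks C (gridSquare B τ (j w)) (gridSquare B τ (j w + 2)) s) :
    W.card * s ≤ (B ^ 2 + 1) ^ 2 * (4 * C.card) := by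
  classical
  obtain ⟨j₀, hj₀⟩ := (W.image j).bddBelow
  obtain ⟨j₁, hj₁⟩ := (W.image j).bddAbove
  have hlow : ∀ w ∈ W, j₀ ≤ j w := fun w hw => hj₀ (by simpa using ⟨w, hw, rfl⟩)
  have hup : ∀ w ∈ W, j w ≤ j₁ := fun w hw => hj₁ (by simpa using ⟨w, hw, rfl⟩)
  have hcell : ∀ n : ℕ, ∀ x ∈ C, ∀ y ∈ C,
      gridSquare B τ (j₀ + n) x = gridSquare B τ (j₀ + n) y →
      gridSquare B τ (j₀ + (n + 1 : ℕ)) x = gridSquare B τ (j₀ + (n + 1 : ℕ)) y := by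
    intro n x _ y _ h
    obtain ⟨h1, h2⟩ := Prod.mk.inj h
    rw [Nat.cast_add_one, ← add_assoc]
    refine Prod.ext ?_ ?_
    · change gridIndex _ _ _ _ = gridIndex _ _ _ _
      rw [gridIndex_succ hB hq, gridIndex_succ hB hq, h1]
    · change gridIndex _ _ _ _ = gridIndex _ _ _ _
      rw [gridIndex_succ hB hq', gridIndex_succ hB hq', h2]
  set M : ℕ := (j₁ - j₀).toNat + 1 with hM
  have hsum := sum_card_splitBlocks_le C (fun n : ℕ => gridSquare B τ (j₀ + n)) s M hcell
  set T : Finset (Σ _ : ℕ, ℤ × ℤ) := (Finset.range M).sigma fun n =>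
    splitBlocks C (gridSquare B τ (j₀ + n)) (gridSquare B τ (j₀ + (n + 2 : ℕ))) s with hT
  have hTcard : s * T.card ≤ 4 * C.card := by rw [hT, Finset.card_sigma]; exact hsum
  have hnat : ∀ w ∈ W, j₀ + ((j w - j₀).toNat : ℤ) = j w := fun w hw => by
    have := hlow w hw; omega
  -- Each pair (level, split block) is charged by at most one point of `W` per subsquare two levels
  -- below.
  have hle : W.card ≤ (B ^ 2 + 1) ^ 2 * T.card := by
    refine Finset.card_le_mul_card_image_of_maps_to
      (f := fun w => (⟨(j w - j₀).toNat, gridSquare B τ (j w + 2) w⟩ : Σ _ : ℕ, ℤ × ℤ)) ?_ _ ?_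
    · intro w hw
      rw [hT, Finset.mem_sigma]
      refine ⟨?_, ?_⟩
      · have := hup w hw
        have := hlow w hw
        simp only [Finset.mem_range]
        omega
      · have := hmem w hw
        simp only
        rwa [Nat.cast_add, ← add_assoc, hnat w hw, Nat.cast_ofNat]
    · rintro ⟨n, v⟩ -
      set k : ℤ := j₀ + n with hk
      have hfib : ∀ w ∈ W.filter (fun w =>
          (⟨(j w - j₀).toNat, gridSquare B τ (j w + 2) w⟩ : Σ _ : ℕ, ℤ × ℤ) = ⟨n, v⟩),
          w ∈ W ∧ j w = k ∧ gridSquare B τ (k + 2) w = v := by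
        intro w hw
        rw [Finset.mem_filter] at hw
        obtain ⟨hw, he⟩ := hw
        obtain ⟨h1, h2⟩ := Sigma.mk.inj he
        have h3 : j w = k := by rw [← hnat w hw, h1]
        exact ⟨hw, h3, by rw [← h3]; exact eq_of_heq h2⟩
      have hBcard : ∀ m : ℤ, (Finset.Icc m (m + (B : ℤ) ^ 2)).card = B ^ 2 + 1 := by
        intro m
        rw [Int.card_Icc]
        have : m + (B : ℤ) ^ 2 + 1 - m = ((B ^ 2 + 1 : ℕ) : ℤ) := by push_cast; ring
        rw [this, Int.toNat_natCast]
      have hbox : ∀ m m' : ℤ, (Finset.Icc m (m + (B : ℤ) ^ 2) ×ˢ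
          Finset.Icc m' (m' + (B : ℤ) ^ 2)).card = (B ^ 2 + 1) ^ 2 := by
        intro m m'
        rw [Finset.card_product, hBcard, hBcard, sq (B ^ 2 + 1)]
      rw [← hbox ⌊(B : ℝ) ^ 2 * (v.1 + τ.1) - τ.1⌋ ⌊(B : ℝ) ^ 2 * (v.2 + τ.2) - τ.2⌋]
      refine Finset.card_le_card_of_injOn (gridSquare B τ k) ?_ ?_
      · intro w hw
        obtain ⟨-, -, h3⟩ := hfib w hw
        obtain ⟨h4, h5⟩ := Prod.ext_iff.1 h3
        exact Finset.mem_coe.2 (Finset.mem_product.2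
          ⟨gridIndex_mem_Icc hB h4, gridIndex_mem_Icc hB h5⟩)
      · intro w hw w' hw' he
        obtain ⟨hw1, hw2, -⟩ := hfib w hw
        obtain ⟨hw1', -, -⟩ := hfib w' hw'
        -- Two points of `W` in one square of level `k` would be closer than `2 B ^ k ≤ 2δρ ≤ ρ`,
        -- against isolation.
        by_contra hne
        have h3 := (hW w hw1).2.1 w' (hWC hw1') (Ne.symm hne)
        have h4 := dist_lt_of_gridSquare_eq hB he.symm
        have h5 := hj w hw1
        rw [hw2] at h5
        have h6 := mul_le_mul_of_nonneg_right hδ' (hW w hw1).1.le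
        linarith
  calc W.card * s ≤ (B ^ 2 + 1) ^ 2 * T.card * s := Nat.mul_le_mul_right _ hle
    _ = (B ^ 2 + 1) ^ 2 * (s * T.card) := by ring
    _ ≤ _ := Nat.mul_le_mul_left _ hTcard

/-- In a finite set of points of the plane, the proportion of points which are supported by `s`
other points in their own scale is of order `1 / s`. -/
theorem exists_card_supported_le {δ : ℝ} (hδ : 0 < δ) (hδ' : δ ≤ 1 / 2) :
    ∃ c : ℕ, ∀ (C W : Finset ℂ) (s : ℕ), W ⊆ C → (∀ w ∈ W, ∃ ρ, IsSupported C δ s w ρ) →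
      W.card * s ≤ c * C.card := by
  classical
  obtain ⟨m, hm⟩ := exists_nat_ge (6 * (1 / δ + δ) / δ)
  -- `B` is large in terms of `δ`, and congruent to 1 modulo 3 so that the grids shifted by `1 / 3`
  -- are nested.
  set B : ℕ := 3 * (m + 1) + 1 with hBdef
  have hB : 0 < B := by omega
  have hB1 : (1 : ℝ) < B := by exact_mod_cast (by omega : 1 < B)
  have hBδ : 6 * (1 / δ + δ) ≤ B * δ := by
    rw [div_le_iff₀ hδ] at hm
    refine hm.trans (mul_le_mul_of_nonneg_right ?_ hδ.le)
    exact_mod_cast (by omega : m ≤ B)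
  refine ⟨4 * ((B ^ 2 + 1) ^ 2 * 4), fun C W s hWC hW => ?_⟩
  choose! ρ hρ using hW
  have hlevel : ∀ w ∈ W, ∃ j : ℤ, (B : ℝ) ^ j ≤ δ * ρ w ∧ δ * ρ w < (B : ℝ) ^ (j + 1) :=
    fun w hw => exists_mem_Ico_zpow (mul_pos hδ (hρ w hw).1) hB1
  choose! j hj hj' using hlevel
  set shifts : Finset (ℝ × ℝ) := {0, 1 / 3} ×ˢ {0, 1 / 3} with hshifts
  have hshift : ∀ w ∈ W, ∃ τ ∈ shifts, gridSquare B τ (j w + 2) w ∈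
      splitBlocks C (gridSquare B τ (j w)) (gridSquare B τ (j w + 2)) s := by
    intro w hw
    obtain ⟨τ, h1, h2, h3⟩ := (hρ w hw).exists_mem_splitBlocks (hWC hw) hB hBδ (hj w hw)
      (hj' w hw)
    exact ⟨τ, by
      rw [hshifts, Finset.mem_product]
      simp only [Finset.mem_insert, Finset.mem_singleton]
      exact ⟨h1, h2⟩, h3⟩
  have hint : ∀ t : ℝ, t ∈ ({0, 1 / 3} : Finset ℝ) → ∃ q : ℤ, ((B : ℝ) - 1) * t = q := by
    intro t ht
    rw [Finset.mem_insert, Finset.mem_singleton] at ht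
    rcases ht with rfl | rfl
    · exact ⟨0, by simp⟩
    · exact ⟨m + 1, by rw [hBdef]; push_cast; ring⟩
  set part : ℝ × ℝ → Finset ℂ := fun τ => W.filter fun w => gridSquare B τ (j w + 2) w ∈
      splitBlocks C (gridSquare B τ (j w)) (gridSquare B τ (j w + 2)) s with hpart
  have hcover : W ⊆ shifts.biUnion part := by
    intro w hw
    obtain ⟨τ, hτ, h⟩ := hshift w hw
    exact Finset.mem_biUnion.2 ⟨τ, hτ, Finset.mem_filter.2 ⟨hw, h⟩⟩
  have hbound : ∀ τ ∈ shifts, (part τ).card * s ≤ (B ^ 2 + 1) ^ 2 * (4 * C.card) := by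
    intro τ hτ
    obtain ⟨h1, h2⟩ := Finset.mem_product.1 hτ
    obtain ⟨q, hq⟩ := hint _ h1
    obtain ⟨q', hq'⟩ := hint _ h2
    have hsub : part τ ⊆ W := Finset.filter_subset _ _
    exact card_supported_shift_le (hsub.trans hWC) hδ' (fun w hw => hρ w (hsub hw)) hB hq hq'
      (fun w hw => hj w (hsub hw)) fun w hw => (Finset.mem_filter.1 hw).2
  have hshiftcard : shifts.card ≤ 4 := by
    rw [hshifts, Finset.card_product]
    have : ({0, 1 / 3} : Finset ℝ).card ≤ 2 := Finset.card_le_two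
    nlinarith
  calc W.card * s ≤ (∑ τ ∈ shifts, (part τ).card) * s :=
        Nat.mul_le_mul_right _ ((Finset.card_le_card hcover).trans Finset.card_biUnion_le)
    _ = ∑ τ ∈ shifts, (part τ).card * s := Finset.sum_mul _ _ _
    _ ≤ shifts.card * ((B ^ 2 + 1) ^ 2 * (4 * C.card)) := by
        rw [← smul_eq_mul]; exact Finset.sum_le_card_nsmul _ _ _ hbound
    _ ≤ 4 * ((B ^ 2 + 1) ^ 2 * (4 * C.card)) := Nat.mul_le_mul_right _ hshiftcard
    _ = _ := by ring

/-! ### Balls and faces of triangulations -/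

namespace CenterEmb

namespace Triangulation

/-- Having an origin in some ball is invariant under `rot` and `opp`, because every edge borders a
triangle; connectedness concludes. -/
theorem exists_mem_ball (T : Triangulation) (o d : T.tri) : ∃ r, (d : T.Dart) ∈ T.ball o r := by
  set Reach : T.Dart → Prop := fun e =>
    ∃ r, T.rot.SameCycle o e ∨ ∃ e' ∈ T.ball o r, T.rot.SameCycle e' e with hReach
  have hcycle : ∀ a b, T.rot.SameCycle a b → Reach a → Reach b := by
    rintro a b hab ⟨r, h⟩
    exact ⟨r, h.imp (fun h => h.trans hab) fun ⟨e', he', h⟩ => ⟨e', he', h.trans hab⟩⟩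
  have hopp : ∀ a, Reach a → Reach (T.opp a) := by
    rintro a ⟨r, h⟩
    rcases T.tri_cover a with ha | ha
    · have ha' : a ∈ T.ball o (r + 1) := ⟨ha, 0, by simpa using h⟩
      refine ⟨r + 1, Or.inr ⟨T.next a, by simpa using T.next_pow_mem_ball _ ha' 1, ?_⟩⟩
      exact (Equiv.Perm.sameCycle_apply_left (f := T.rot)).2 (Equiv.Perm.SameCycle.refl _ _)
    · have hn : T.next (T.opp a) = T.rot a := congrArg T.rot (T.opp_opp a)
      refine ⟨r + 1, Or.inr ⟨T.opp a, ⟨ha, 1, ?_⟩, Equiv.Perm.SameCycle.refl _ _⟩⟩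
      simpa only [pow_one, hn, Equiv.Perm.sameCycle_apply_right] using h
  have hstep : ∀ a b, Relation.EqvGen (fun a b => b = T.opp a ∨ b = T.rot a) a b →
      (Reach a ↔ Reach b) := by
    intro a b h
    induction h with
    | rel a b h =>
      rcases h with rfl | rfl
      · exact ⟨hopp a, fun h => by simpa only [T.opp_opp] using hopp _ h⟩
      · exact ⟨hcycle _ _ (Equiv.Perm.sameCycle_apply_right.2 (Equiv.Perm.SameCycle.refl _ _)),
          hcycle _ _ (Equiv.Perm.sameCycle_apply_left.2 (Equiv.Perm.SameCycle.refl _ _))⟩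
    | refl => rfl
    | symm _ _ _ ih => exact ih.symm
    | trans _ _ _ _ _ h1 h2 => exact h1.trans h2
  obtain ⟨r, h⟩ := (hstep _ _ (T.connected o d)).1 ⟨0, Or.inl (Equiv.Perm.SameCycle.refl _ _)⟩
  exact ⟨r + 1, d.2, 0, by simpa using h⟩

theorem face_surjective (T : Triangulation) : Function.Surjective T.face := Quotient.mk_surjective

instance (T : Triangulation) [Finite T.Dart] : Finite T.Face := Finite.of_surjective _ T.face_surjective

theorem eq_or_eq_of_face_eq (T : Triangulation) {d e : T.tri} (h : T.face d = T.face e) :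
    (e : T.Dart) = d ∨ (e : T.Dart) = T.next d ∨ (e : T.Dart) = T.next (T.next d) := by
  obtain ⟨i, hi⟩ : T.next.SameCycle (d : T.Dart) e := Quotient.exact h
  have h3 : ∀ m : ℤ, ((T.next ^ (3 : ℤ)) ^ m) (d : T.Dart) = d := fun m =>
    Equiv.Perm.zpow_apply_eq_self_of_apply_eq_self (T.tri_three d d.2) m
  rw [← Int.emod_add_mul_ediv i 3, zpow_add, zpow_mul, Equiv.Perm.mul_apply, h3] at hi
  have h0 := Int.emod_nonneg i (by norm_num : (3 : ℤ) ≠ 0)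
  have h1 := Int.emod_lt_of_pos i (by norm_num : (0 : ℤ) < 3)
  rw [← hi]
  have : i % 3 = 0 ∨ i % 3 = 1 ∨ i % 3 = 2 := by omega
  rcases this with h | h | h <;> rw [h]
  · exact Or.inl rfl
  · exact Or.inr (Or.inl rfl)
  · exact Or.inr (Or.inr rfl)

end Triangulation

/-! ### Openness of the cluster event, and its geometric meaning -/

namespace CenterEmbedding

theorem eventually_exists_dist_lt (E : CenterEmbedding) (f : E.T.Face) {η : ℝ} (hη : 0 < η) :
    ∀ᶠ E' in 𝓝 E, ∃ f', dist (E'.g f') (E.g f) < η := by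
  obtain ⟨d, rfl⟩ := E.T.face_surjective f
  obtain ⟨r, hr⟩ := E.T.exists_mem_ball E.root d
  -- A radius `ε` below `1 / (r + 1)` has `⌊ε⁻¹⌋₊ ≥ r`, so the agreement reaches the ball containing
  -- `d`.
  refine Metric.eventually_nhds_iff.2 ⟨min η (1 / (r + 1)), by positivity, fun E' h => ?_⟩
  rw [dist_comm] at h
  obtain ⟨ε, ⟨hε, hag⟩, hlt⟩ := exists_lt_of_csInf_lt ⟨_, two_mem_agreeSet E E'⟩ h
  have hrε : r ≤ ⌊ε⁻¹⌋₊ := by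
    refine Nat.le_floor ?_
    have h1 := hlt.le.trans (min_le_right _ _)
    rw [le_div_iff₀ (by positivity)] at h1
    rw [← one_div, le_div_iff₀ hε]
    nlinarith
  obtain ⟨ψ, -, hψ⟩ := hag.mono hrε
  refine ⟨E'.ballFace (ψ.toEquiv ⟨d, hr⟩), ?_⟩
  rw [dist_comm, Complex.dist_eq]
  exact (hψ ⟨d, hr⟩).trans_lt (hlt.trans_le (min_le_left _ _))

/-- Having at least `s` centers in a given open set is an open condition. -/
theorem isOpen_setOf_le_encard {V : Set ℂ} (hV : IsOpen V) (s : ℕ) :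
    IsOpen {E : CenterEmbedding | (s : ℕ∞) ≤ (range E.g ∩ V).encard} := by
  refine isOpen_iff_eventually.2 fun E hE => ?_
  obtain ⟨A, hA, hAs⟩ := Set.exists_subset_encard_eq hE
  have hAfin : A.Finite := Set.finite_of_encard_eq_coe hAs
  -- Disjoint neighbourhoods keep the perturbed centers distinct.
  obtain ⟨U, hU, hdisj⟩ := hAfin.t2_separation
  have hev : ∀ᶠ E' : CenterEmbedding in 𝓝 E, ∀ x ∈ A, ∃ y, y ∈ range E'.g ∩ V ∧ y ∈ U x := by
    refine (Filter.eventually_all_finite hAfin).2 fun x hx => ?_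
    obtain ⟨⟨f, rfl⟩, hxV⟩ := hA hx
    obtain ⟨η, hη, hball⟩ := Metric.isOpen_iff.1 (hV.inter (hU (E.g f)).2) (E.g f)
      ⟨hxV, (hU (E.g f)).1⟩
    filter_upwards [E.eventually_exists_dist_lt f hη] with E' ⟨f', hf'⟩
    exact ⟨E'.g f', ⟨⟨f', rfl⟩, (hball hf').1⟩, (hball hf').2⟩
  filter_upwards [hev] with E' hE'
  choose! y hy hyU using hE'
  have hinj : Set.InjOn y A := by
    intro x hx x' hx' he
    by_contra hne
    exact Set.disjoint_left.1 (hdisj hx hx' hne) (hyU x hx) (he ▸ hyU x' hx')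
  rw [← hAs, ← hinj.encard_image]
  exact Set.encard_le_encard (Set.image_subset_iff.2 hy)

/-- The set of center embeddings with two distant discs of radius `δ`, each with at least `s`
centers. -/
def twoClusters (δ : ℝ) (s : ℕ) : Set CenterEmbedding :=
  {E | ∃ a b : ℂ, ‖a‖ ≤ 1 / δ ∧ ‖b‖ ≤ 1 / δ ∧ 4 * δ ≤ dist a b ∧
    (s : ℕ∞) ≤ (range E.g ∩ Metric.ball a δ).encard ∧
    (s : ℕ∞) ≤ (range E.g ∩ Metric.ball b δ).encard}

theorem isOpen_twoClusters (δ : ℝ) (s : ℕ) : IsOpen (twoClusters δ s) := by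
  refine isOpen_iff_eventually.2 fun E hE => ?_
  obtain ⟨a, b, ha, hb, hab, h1, h2⟩ := hE
  filter_upwards [(isOpen_setOf_le_encard (Metric.isOpen_ball (x := a) (ε := δ)) s).mem_nhds h1,
    (isOpen_setOf_le_encard (Metric.isOpen_ball (x := b) (ε := δ)) s).mem_nhds h2] with E' h1 h2
  exact ⟨a, b, ha, hb, hab, h1, h2⟩

/-- Countably many values of `δ` suffice for the null set argument; the `+ 2` also ensures `δ ≤ 1 /
2`, as the counting of supported points requires. -/
theorem exists_forall_mem_twoClusters (E : CenterEmbedding)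
    (h : ¬ {p : ℂ | AccPt p (𝓟 (range E.g))}.Subsingleton) :
    ∃ n : ℕ, ∀ s, E ∈ twoClusters (1 / (n + 2)) s := by
  rw [Set.not_subsingleton_iff] at h
  obtain ⟨a, ha, b, hb, hab⟩ := h
  obtain ⟨n, hn⟩ := exists_nat_ge (max (max ‖a‖ ‖b‖) (4 / dist a b))
  simp only [max_le_iff] at hn
  have hδ : (0 : ℝ) < 1 / (n + 2) := by positivity
  have hd : 0 < dist a b := dist_pos.2 hab
  have hcl : ∀ p : ℂ, AccPt p (𝓟 (range E.g)) → ∀ s : ℕ,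
      (s : ℕ∞) ≤ (range E.g ∩ Metric.ball p (1 / (n + 2))).encard := by
    intro p hp s
    have hinf : (range E.g ∩ Metric.ball p (1 / (n + 2))).Infinite := by
      refine Set.Infinite.of_accPt (x := p) ?_
      rw [Set.inter_comm]
      exact hp.nhds_inter (Metric.ball_mem_nhds p hδ)
    rw [hinf.encard_eq]
    exact le_top
  refine ⟨n, fun s => ⟨a, b, ?_, ?_, ?_, hcl a ha s, hcl b hb s⟩⟩
  · rw [one_div_one_div]; linarith [hn.1.1]
  · rw [one_div_one_div]; linarith [hn.1.2]
  · rw [mul_one_div, div_le_iff₀ (by positivity)]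
    have := (div_le_iff₀ hd).1 hn.2
    nlinarith

/-- If `g = αφ + β`, then `ρ = 1 / α` is the preimage of unit length: the normalization of `g`
becomes isolation at scale `ρ`, and discs of radius `δ` become discs of radius `δρ`. -/
theorem isSupported_of_mem_twoClusters {E : CenterEmbedding} {δ : ℝ} {s : ℕ}
    (hE : E ∈ twoClusters δ s) {φ : E.T.Face → ℂ} (hφ : Similar φ E.g) {C : Finset ℂ}
    (hC : (C : Set ℂ) = range φ) : ∃ ρ, IsSupported C δ s (φ (E.T.face E.root)) ρ := by
  classical
  obtain ⟨a, b, ha, hb, hab, hsa, hsb⟩ := hE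
  obtain ⟨α, β, hα, hg⟩ := hφ
  have hα' : (α : ℂ) ≠ 0 := by exact_mod_cast hα.ne'
  have hdist : ∀ z w : ℂ, dist ((α : ℂ) * z + β) (α * w + β) = α * dist z w := by
    intro z w
    rw [Complex.dist_eq, Complex.dist_eq, add_sub_add_right_eq_sub, ← mul_sub, norm_mul,
      Complex.norm_real, Real.norm_of_nonneg hα.le]
  have hinv : ∀ z : ℂ, ∃ w : ℂ, (α : ℂ) * w + β = z := fun z => ⟨(z - β) / α, by field_simp; ring⟩
  have hroot : (α : ℂ) * φ (E.T.face E.root) + β = 0 := by rw [← hg, E.g_root]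
  have hcount : ∀ a : ℂ, (s : ℕ∞) ≤ (range E.g ∩ Metric.ball ((α : ℂ) * a + β) δ).encard →
      s ≤ (C.filter fun x => dist x a < δ * (1 / α)).card := by
    intro a h
    have hsub : range E.g ∩ Metric.ball ((α : ℂ) * a + β) δ ⊆
        (fun x => (α : ℂ) * x + β) '' (C.filter fun x => dist x a < δ * (1 / α) : Finset ℂ) := by
      rintro _ ⟨⟨f, rfl⟩, hf⟩
      refine ⟨φ f, ?_, (hg f).symm⟩
      rw [Metric.mem_ball, hg, hdist] at hf
      rw [Finset.mem_coe, Finset.mem_filter]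
      refine ⟨by rw [← Finset.mem_coe, hC]; exact mem_range_self f, ?_⟩
      rw [mul_one_div, lt_div_iff₀ hα]
      linarith
    have := (h.trans (Set.encard_le_encard hsub)).trans (Set.encard_image_le _ _)
    rw [Set.encard_coe_eq_coe_finsetCard] at this
    exact_mod_cast this
  obtain ⟨a, rfl⟩ := hinv a
  obtain ⟨b, rfl⟩ := hinv b
  have hnear : ∀ a : ℂ, ‖(α : ℂ) * a + β‖ ≤ 1 / δ → dist a (φ (E.T.face E.root)) ≤ 1 / α / δ := by
    intro a ha
    have h := hdist a (φ (E.T.face E.root))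
    rw [hroot, dist_zero_right] at h
    rw [div_right_comm, le_div_iff₀ hα]
    linarith
  refine ⟨1 / α, by positivity, ?_, a, b, hnear a ha, hnear b hb, ?_, hcount a hsa, hcount b hsb⟩
  · intro x hx hne
    obtain ⟨f, rfl⟩ : x ∈ range φ := by rw [← hC]; exact hx
    have h1 : 1 ≤ ‖E.g f‖ := E.normalized.1 ⟨f, fun h => hne (by rw [h]), rfl⟩
    have h := hdist (φ f) (φ (E.T.face E.root))
    rw [hroot, dist_zero_right, ← hg] at h
    rw [div_le_iff₀ hα]
    linarith
  · rw [hdist] at hab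
    rw [mul_one_div, mul_div_assoc', div_le_iff₀ hα]
    linarith

end CenterEmbedding

/-! ### Averaging over the uniform root -/

/-- A bound for the number of supported centers bounds the number of roots at such centers. -/
theorem card_supported_roots_le {T : Triangulation} [Fintype T.tri] {φ : T.Face → ℂ}
    (hφ : Function.Injective φ) {C : Finset ℂ} (hC : (C : Set ℂ) = range φ) {δ : ℝ} {s c : ℕ}
    (hc : ∀ W ⊆ C, (∀ w ∈ W, ∃ ρ, IsSupported C δ s w ρ) → W.card * s ≤ c * C.card)
    (R : Finset T.tri) (hR : ∀ o ∈ R, ∃ ρ, IsSupported C δ s (φ (T.face o)) ρ) :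
    R.card * s ≤ 3 * c * Fintype.card T.tri := by
  classical
  set f : T.tri → ℂ := fun o => φ (T.face o) with hf
  have hmemC : ∀ o, f o ∈ C := fun o => by rw [← Finset.mem_coe, hC]; exact mem_range_self _
  -- A triangle carries at most three roots, and distinct triangles have distinct centers.
  have h1 : R.card ≤ 3 * (R.image f).card := by
    refine Finset.card_le_mul_card_image R 3 fun z hz => ?_
    obtain ⟨o, ho, rfl⟩ := Finset.mem_image.1 hz
    refine (Finset.card_le_card_of_injOn (t := {(o : T.Dart), T.next o, T.next (T.next o)})
      Subtype.val ?_ Subtype.val_injective.injOn).trans Finset.card_le_three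
    intro o' ho'
    have := T.eq_or_eq_of_face_eq (hφ (Finset.mem_filter.1 ho').2.symm)
    simpa using this
  have h2 := hc (R.image f) (fun z hz => by
      obtain ⟨o, -, rfl⟩ := Finset.mem_image.1 hz; exact hmemC o) (fun z hz => by
      obtain ⟨o, ho, rfl⟩ := Finset.mem_image.1 hz; exact hR o ho)
  have h3 : C.card ≤ Fintype.card T.tri := by
    have : C ⊆ Finset.univ.image f := by
      intro z hz
      obtain ⟨x, rfl⟩ : z ∈ range φ := by rw [← hC]; exact hz
      obtain ⟨o, rfl⟩ := T.face_surjective x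
      exact Finset.mem_image_of_mem f (Finset.mem_univ o)
    exact (Finset.card_le_card this).trans Finset.card_image_le
  calc R.card * s ≤ 3 * (R.image f).card * s := Nat.mul_le_mul_right _ h1
    _ = 3 * ((R.image f).card * s) := by ring
    _ ≤ 3 * (c * Fintype.card T.tri) :=
        Nat.mul_le_mul_left _ (h2.trans (Nat.mul_le_mul_left _ h3))
    _ = _ := by ring

/-- A rooted triangulation is a triangulation with an oriented triangle. -/
def sigmaEquivRooted : (Σ T : Triangulation, T.tri) ≃ RootedTriangulation where
  toFun X := ⟨X.1, X.2⟩
  invFun X := ⟨X.T, X.root⟩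
  left_inv _ := rfl
  right_inv _ := rfl

theorem tsum_rooted (f : RootedTriangulation → ENNReal) :
    ∑' X, f X = ∑' T : Triangulation, ∑' o : T.tri, f ⟨T, o⟩ := by
  rw [← sigmaEquivRooted.tsum_eq]
  exact ENNReal.tsum_sigma fun (T : Triangulation) (o : T.tri) => f ⟨T, o⟩

/-- Since `φ` depends on the triangulation alone, the cluster event is contained in one about the
rooted triangulation. For fixed `T` all roots have equal mass, so the mass of the bad roots is their
proportion, at most `3c / s`. -/
theorem law_twoClusters_mul_le {Q : PMF CenterEmbedding} (hfin : IsFinite Q) (hunb : IsUnbiased Q)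
    (hdet : IsDetermined Q) {δ : ℝ} {s c : ℕ}
    (hc : ∀ C W : Finset ℂ, W ⊆ C → (∀ w ∈ W, ∃ ρ, IsSupported C δ s w ρ) →
      W.card * s ≤ c * C.card) :
    (law Q : Measure CenterEmbedding) (CenterEmbedding.twoClusters δ s) * s ≤ 3 * c := by
  classical
  obtain ⟨φ, -, hφ⟩ := hdet
  set p : PMF RootedTriangulation := Q.map CenterEmbedding.toRootedTriangulation with hp
  set A : Set RootedTriangulation := {X | ∃ C : Finset ℂ, (C : Set ℂ) = range (φ X.T) ∧
    ∃ ρ, IsSupported C δ s (φ X.T (X.T.face X.root)) ρ} with hA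
  have hsupp : ∀ X ∈ p.support, Finite X.T.Dart ∧ Function.Injective (φ X.T) := by
    intro X hX
    obtain ⟨E, hE, rfl⟩ := (PMF.mem_support_map_iff _ _ _).1 hX
    refine ⟨hfin E hE, fun x y hxy => ?_⟩
    obtain ⟨a, b, -, h⟩ := hφ E hE
    exact E.inj (by rw [h, h, hxy])
  have hle : (law Q : Measure CenterEmbedding) (CenterEmbedding.twoClusters δ s) ≤
      ∑' X, A.indicator p X := by
    have h1 : (law Q : Measure CenterEmbedding) (CenterEmbedding.twoClusters δ s) =
        Q.toOuterMeasure (CenterEmbedding.twoClusters δ s) :=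
      PMF.toMeasure_apply_eq_toOuterMeasure_apply _
        (CenterEmbedding.isOpen_twoClusters δ s).measurableSet
    rw [h1, ← PMF.toOuterMeasure_apply, hp, PMF.toOuterMeasure_map_apply]
    refine PMF.toOuterMeasure_mono _ ?_
    rintro E ⟨hE, hES⟩
    have := hfin E hES
    have hC : ((Set.finite_range (φ E.T)).toFinset : Set ℂ) = range (φ E.T) :=
      Set.Finite.coe_toFinset _
    exact ⟨_, hC, CenterEmbedding.isSupported_of_mem_twoClusters hE (hφ E hES) hC⟩
  have hT : ∀ T : Triangulation, (∑' o : T.tri, A.indicator p ⟨T, o⟩) * s ≤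
      3 * c * ∑' o : T.tri, p ⟨T, o⟩ := by
    intro T
    -- Finiteness of `T` and injectivity of `φ T` are known only for triangulations that occur with
    -- positive mass.
    by_cases h0 : ∀ o : T.tri, p ⟨T, o⟩ = 0
    · have : ∀ o : T.tri, A.indicator p ⟨T, o⟩ = 0 := fun o =>
        le_antisymm ((Set.indicator_le_self A (p : RootedTriangulation → ENNReal) _).trans (h0 o).le)
          zero_le
      simp [this]
    · push Not at h0
      obtain ⟨o₀, ho₀⟩ := h0
      obtain ⟨hTfin, hinj⟩ := hsupp ⟨T, o₀⟩ ((PMF.mem_support_iff _ _).2 ho₀)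
      have : Finite T.Dart := hTfin
      have : Fintype T.tri := Fintype.ofFinite _
      have hconst : ∀ o : T.tri, p ⟨T, o⟩ = p ⟨T, o₀⟩ := fun o => hunb T o o₀
      have hC : ((Set.finite_range (φ T)).toFinset : Set ℂ) = range (φ T) :=
        Set.Finite.coe_toFinset _
      have hcard := card_supported_roots_le hinj hC (hc _)
        (Finset.univ.filter fun o : T.tri => (⟨T, o⟩ : RootedTriangulation) ∈ A) (fun o ho => by
          obtain ⟨C, hC', ρ, h⟩ := (Finset.mem_filter.1 ho).2
          have hCC := Finset.coe_injective (hC'.trans hC.symm)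
          subst hCC
          exact ⟨ρ, h⟩)
      rw [tsum_fintype, tsum_fintype]
      simp only [Set.indicator_apply, hconst]
      rw [← Finset.sum_filter, Finset.sum_const, Finset.sum_const, Finset.card_univ, nsmul_eq_mul,
        nsmul_eq_mul, mul_right_comm, ← mul_assoc]
      refine mul_le_mul_left ?_ _
      exact_mod_cast hcard
  calc (law Q : Measure CenterEmbedding) (CenterEmbedding.twoClusters δ s) * s
      ≤ (∑' X, A.indicator p X) * s := mul_le_mul_left hle _
    _ = ∑' T : Triangulation, (∑' o : T.tri, A.indicator p ⟨T, o⟩) * s := by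
        rw [tsum_rooted, ENNReal.tsum_mul_right]
    _ ≤ ∑' T : Triangulation, 3 * c * ∑' o : T.tri, p ⟨T, o⟩ := ENNReal.tsum_le_tsum hT
    _ = 3 * c * ∑' X, p X := by
        rw [tsum_rooted, ENNReal.tsum_mul_left]
    _ = 3 * c := by rw [p.tsum_coe, mul_one]

end CenterEmb

end

/-- Every subsequential limit in distribution of random unbiased finite center embeddings, whose
unrooted triangulation determines the embedding, has almost surely at most one accumulation point in
the plane. -/
theorem proposition1p5 (Q : ℕ → PMF CenterEmb.CenterEmbedding)
    (hfin : ∀ n, CenterEmb.IsFinite (Q n))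
    (hunb : ∀ n, CenterEmb.IsUnbiased (Q n))
    (hdet : ∀ n, CenterEmb.IsDetermined (Q n))
    (k : ℕ → ℕ) (hk : StrictMono k)
    (P : ProbabilityMeasure CenterEmb.CenterEmbedding)
    (hlim : Tendsto (fun n => CenterEmb.law (Q (k n))) atTop (𝓝 P)) :
    ∀ᵐ E ∂(P : Measure CenterEmb.CenterEmbedding),
      {p : ℂ | AccPt p (𝓟 (range E.g))}.Subsingleton := by
  have hnull : ∀ n : ℕ, (P : Measure CenterEmb.CenterEmbedding)
      (⋂ s, CenterEmb.CenterEmbedding.twoClusters (1 / (n + 2)) s) = 0 := by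
    intro n
    have hδ : (0 : ℝ) < 1 / (n + 2) := by positivity
    obtain ⟨c, hc⟩ := exists_card_supported_le hδ
      (one_div_le_one_div_of_le two_pos (by linarith [n.cast_nonneg (α := ℝ)]))
    by_contra hne
    -- The constant `c` was fixed before `s`, so `s` can be taken large enough to beat `3c` against
    -- a positive limit mass.
    obtain ⟨s, hs⟩ := ENNReal.exists_nat_mul_gt hne
      (ENNReal.mul_ne_top (ENNReal.natCast_ne_top 3) (ENNReal.natCast_ne_top c))
    have hs0 : (s : ENNReal) ≠ 0 := by rintro h; simp [h] at hs
    have hopen := CenterEmb.CenterEmbedding.isOpen_twoClusters (1 / ((n : ℝ) + 2)) s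
    have h1 := ProbabilityMeasure.le_liminf_measure_open_of_tendsto hlim hopen
    have h2 : atTop.liminf (fun i => (CenterEmb.law (Q (k i)) : Measure CenterEmb.CenterEmbedding)
        (CenterEmb.CenterEmbedding.twoClusters (1 / ((n : ℝ) + 2)) s)) ≤ 3 * c / s := by
      refine (liminf_le_liminf (Eventually.of_forall fun i => ?_)).trans (liminf_const _).le
      rw [ENNReal.le_div_iff_mul_le (Or.inl hs0) (Or.inl (ENNReal.natCast_ne_top s))]
      exact CenterEmb.law_twoClusters_mul_le (hfin _) (hunb _) (hdet _) fun C W => hc C W s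
    have h3 := (measure_mono (μ := (P : Measure CenterEmb.CenterEmbedding))
      (iInter_subset _ s)).trans (h1.trans h2)
    rw [ENNReal.le_div_iff_mul_le (Or.inl hs0) (Or.inl (ENNReal.natCast_ne_top s)), mul_comm] at h3
    exact absurd (hs.trans_le h3) (by simp)
  refine ae_iff.2 (measure_mono_null (fun E hE => ?_) (measure_iUnion_null hnull))
  obtain ⟨n, hn⟩ := E.exists_forall_mem_twoClusters hE
  exact mem_iUnion.2 ⟨n, mem_iInter.2 hn⟩
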